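/- Let $G$ be a finite group of order $n$, let $\xi\in\mathbb{C}$ be a primitive $n$-th root of unity, and let $\mathrm{Cl}(G)$ be the set of conjugacy classes of $G$. Let $R(G)$ be the ring of $\mathbb{Z}$-linear combinations of the irreducible complex characters of $G$, regarded as functions $\mathrm{Cl}(G)\to\mathbb{Z}[\xi]$ with pointwise operations, and let $C:=\mathrm{Spec}(R(G)\otimes_{\mathbb{Z}}\mathbb{Z}[\xi])$. For $Q\in\mathrm{Spec}\,\mathbb{Z}[\xi]$ and $c\in\mathrm{Cl}(G)$, let $(Q)_c\in C$ be the inverse image of the prime ideal $\{f:\mathrm{Cl}(G)\to\mathbb{Z}[\xi]\mid f(c)\in Q\}$ of $\mathbb{Z}[\xi]^{\mathrm{Cl}(G)}$ under the canonical map $R(G)\otimes_{\mathbb{Z}}\mathbb{Z}[\xi]\to\mathbb{Z}[\xi]^{\mathrm{Cl}(G)}$, $\chi\otimes a\mapsto(c'\mapsto a\chi(c'))$. For a prime $p$, each $g\in G$ can be written uniquely as $g=g_u^{(p)}g_r^{(p)}$ with $g_u^{(p)},g_r^{(p)}\in\langle g\rangle$, the order of $g_u^{(p)}$ a power of $p$,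 and the order of $g_r^{(p)}$ not divisible by $p$; for a conjugacy class $c$ set $c_r^{(p)}:=\{g_r^{(p)}\mid g\in c\}$. A point $P$ of $C$ is called nonsingular if the local ring $\mathcal{O}_{C,P}$ is regular, i.e. if $\dim_{k_P}(\mathfrak{m}_P/\mathfrak{m}_P^2)=\dim\mathcal{O}_{C,P}$ (Krull dimension), where $\mathfrak{m}_P$ is its maximal ideal and $k_P$ its residue field; otherwise $P$ is called singular. **Proposition.** Let $Q\in\mathrm{Spec}\,\mathbb{Z}[\xi]$, $c\in\mathrm{Cl}(G)$, $P=(Q)_c\in C$, and let $p\geq 0$ be the characteristic of $\mathbb{Z}[\xi]/Q$. (I) The following are equivalent: (i) $P$ is singular; (ii) $P$ belongs to two distinct irreducible components of $C$; (iii) $Q\neq(0)$ and there is a class $d\in\mathrm{Cl}(G)$, $d\neq c$, with $c_r^{(p)}=d_r^{(p)}$. (II) If $p\nmid|G|$, then $P$ is nonsingular. -/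

import Mathlib

namespace RepSpec

open scoped TensorProduct

/-- The character of a complex representation, viewed as a function on the conjugacy classes. -/
noncomputable def classChar {G : Type*} [Group G] {V : Type} [AddCommGroup V] [Module ℂ V]
    (ρ : Representation ℂ G V) : ConjClasses G → ℂ :=
  Quotient.lift ρ.character (by
    intro a b h
    obtain ⟨c, rfl⟩ := isConj_iff.mp h
    have h1 := Representation.char_mul_comm ρ c (a * c⁻¹)
    rw [mul_assoc, ← h1, inv_mul_cancel_right])

/-- The set of irreducible complex characters `χ₁, …, χₛ` of `G`. -/
def irrChars (G : Type*) [Group G] : Set (ConjClasses G → ℂ) :=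
  {χ | ∃ (V : Type) (_ : AddCommGroup V) (_ : Module ℂ V) (_ : FiniteDimensional ℂ V)
    (ρ : Representation ℂ G V), ρ.IsIrreducible ∧ χ = classChar ρ}

lemma classChar_of_isCompl {G : Type*} [Group G] {V : Type} [AddCommGroup V] [Module ℂ V]
    [FiniteDimensional ℂ V] (ρ : Representation ℂ G V) (W U : Subrepresentation ρ)
    (h : IsCompl W U) :
    classChar ρ = classChar W.toRepresentation + classChar U.toRepresentation := by
  have hc : IsCompl W.toSubmodule U.toSubmodule := by
    rw [isCompl_iff, disjoint_iff, codisjoint_iff] at h ⊢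
    exact ⟨congrArg Subrepresentation.toSubmodule h.1, congrArg Subrepresentation.toSubmodule h.2⟩
  funext c
  induction c using Quotient.inductionOn with
  | h g =>
    change LinearMap.trace ℂ V (ρ g) = LinearMap.trace ℂ _ (W.toRepresentation g) +
      LinearMap.trace ℂ _ (U.toRepresentation g)
    rw [← LinearMap.trace_prodMap', ← LinearMap.trace_conj' _
      (Submodule.prodEquivOfIsCompl W.toSubmodule U.toSubmodule hc)]
    congr 1
    apply LinearMap.ext
    intro v
    obtain ⟨x, rfl⟩ := (Submodule.prodEquivOfIsCompl W.toSubmodule U.toSubmodule hc).surjective v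
    rw [LinearEquiv.conj_apply_apply, LinearEquiv.symm_apply_apply]
    simp [Submodule.coe_prodEquivOfIsCompl', Subrepresentation.toRepresentation]

/-- Every character is a sum of irreducible characters. -/
lemma classChar_mem {G : Type*} [Group G] [Finite G] (n : ℕ) :
    ∀ {V : Type} [AddCommGroup V] [Module ℂ V] [FiniteDimensional ℂ V]
    (ρ : Representation ℂ G V), Module.finrank ℂ V = n →
    classChar ρ ∈ AddSubgroup.closure (irrChars G) := by
  induction n using Nat.strong_induction_on with
  | _ n ih =>
    intro V _ _ _ ρ hn
    rcases subsingleton_or_nontrivial V with hV | hV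
    · have : classChar ρ = 0 := by
        funext c
        induction c using Quotient.inductionOn with
        | h g =>
          change LinearMap.trace ℂ V (ρ g) = 0
          rw [Subsingleton.elim (ρ g) 0, map_zero]
      rw [this]
      exact zero_mem _
    by_cases hirr : ρ.IsIrreducible
    · exact AddSubgroup.subset_closure ⟨V, _, _, inferInstance, ρ, hirr, rfl⟩
    have hnt : Nontrivial (Subrepresentation ρ) := by
      refine ⟨⊥, ⊤, fun h => ?_⟩
      exact bot_ne_top (α := Submodule ℂ V) (congrArg Subrepresentation.toSubmodule h)
    have hex : ∃ W : Subrepresentation ρ, W ≠ ⊥ ∧ W ≠ ⊤ := by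
      by_contra! hcon
      exact hirr ⟨fun W => or_iff_not_imp_left.mpr (hcon W)⟩
    obtain ⟨W, hW0, hW1⟩ := hex
    have : NeZero (Nat.card G : ℂ) := ⟨by exact_mod_cast Nat.card_pos.ne'⟩
    obtain ⟨U, hU⟩ := exists_isCompl W
    have key : ∀ X : Subrepresentation ρ, X ≠ ⊤ →
        classChar X.toRepresentation ∈ AddSubgroup.closure (irrChars G) := by
      intro X hX
      refine ih _ ?_ X.toRepresentation rfl
      rw [← hn]
      apply Submodule.finrank_lt
      intro h
      exact hX (Subrepresentation.toSubmodule_injective h)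
    rw [classChar_of_isCompl ρ W U hU]
    refine add_mem (key W hW1) (key U ?_)
    rintro rfl
    exact hW0 (by simpa using hU.inf_eq_bot)

/-- The representation ring `R(G)`: the `ℤ`-linear combinations of the irreducible complex
characters of `G`, with the pointwise product. -/
def repRing (G : Type*) [Group G] [Finite G] : Subring (ConjClasses G → ℂ) where
  __ := AddSubgroup.closure (irrChars G)
  one_mem' := by
    have h : (1 : ConjClasses G → ℂ) = classChar (Representation.trivial ℂ G ℂ) := by
      funext c
      induction c using Quotient.inductionOn with
      | h g =>
        change (1 : ℂ) = LinearMap.trace ℂ ℂ (1 : ℂ →ₗ[ℂ] ℂ)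
        simp
    rw [h]
    exact classChar_mem _ _ rfl
  mul_mem' := by
    intro a b ha hb
    change a ∈ AddSubgroup.closure (irrChars G) at ha
    change b ∈ AddSubgroup.closure (irrChars G) at hb
    change a * b ∈ AddSubgroup.closure (irrChars G)
    induction ha, hb using AddSubgroup.closure_induction₂ with
    | mem x y hx hy =>
      obtain ⟨V, _, _, _, ρ, -, rfl⟩ := hx
      obtain ⟨W, _, _, _, σ, -, rfl⟩ := hy
      have h : classChar ρ * classChar σ = classChar (ρ.tprod σ) := by
        funext c
        induction c using Quotient.inductionOn with
        | h g => exact (congrFun (Representation.char_tensor ρ σ) g).symm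
      rw [h]
      exact classChar_mem _ _ rfl
    | zero_left => simp
    | zero_right => simp
    | add_left x y z _ _ _ h1 h2 => rw [add_mul]; exact add_mem h1 h2
    | add_right x y z _ _ _ h1 h2 => rw [mul_add]; exact add_mem h1 h2
    | neg_left x y _ _ h => rw [neg_mul]; exact neg_mem h
    | neg_right x y _ _ h => rw [mul_neg]; exact neg_mem h

/-- The ring `ℤ[ξ]`, as a subring of `ℂ`. -/
abbrev ZXi (ξ : ℂ) : Subalgebra ℤ ℂ := Algebra.adjoin ℤ {ξ}

/-- If `ξ` is a primitive root of unity of order `|G|`, then virtual characters take values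
in `ℤ[ξ]`. -/
lemma repRing_apply_mem {G : Type*} [Group G] [Finite G] {ξ : ℂ}
    (hξ : IsPrimitiveRoot ξ (Nat.card G)) (χ : repRing G) (c : ConjClasses G) :
    (χ : ConjClasses G → ℂ) c ∈ ZXi ξ := by
  obtain ⟨χ, hχ⟩ := χ
  change χ ∈ AddSubgroup.closure (irrChars G) at hχ
  change χ c ∈ ZXi ξ
  induction hχ using AddSubgroup.closure_induction with
  | zero => exact zero_mem _
  | add x y _ _ h1 h2 => exact add_mem h1 h2
  | neg x _ h => exact neg_mem h
  | mem x hx =>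
    obtain ⟨V, _, _, _, ρ, -, rfl⟩ := hx
    induction c using Quotient.inductionOn with
    | h g =>
      change LinearMap.trace ℂ V (ρ g) ∈ ZXi ξ
      rw [Module.End.trace_eq_sum_roots_charpoly_of_splits (IsAlgClosed.splits _)]
      apply multiset_sum_mem
      intro μ hμ
      have hev : Module.End.HasEigenvalue (ρ g) μ := by
        rw [Module.End.hasEigenvalue_iff_isRoot_charpoly]
        exact Polynomial.isRoot_of_mem_roots hμ
      obtain ⟨v, hv⟩ := hev.exists_hasEigenvector
      have hpow := hv.pow_apply (Nat.card G)
      rw [← map_pow, pow_card_eq_one', map_one, Module.End.one_apply] at hpow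
      have hone : μ ^ Nat.card G = 1 := by
        have : (μ ^ Nat.card G - 1) • v = 0 := by
          rw [sub_smul, one_smul, ← hpow, sub_self]
        rcases smul_eq_zero.mp this with h | h
        · exact sub_eq_zero.mp h
        · exact absurd h hv.2
      have : NeZero (Nat.card G) := ⟨Nat.card_pos.ne'⟩
      obtain ⟨i, -, rfl⟩ := hξ.eq_pow_of_pow_eq_one hone
      have hmem : ξ ∈ ZXi ξ := Algebra.subset_adjoin (Set.mem_singleton ξ)
      exact pow_mem hmem i

/-- The ring `R(G) ⊗_ℤ ℤ[ξ]`. -/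
abbrev RBar (G : Type*) [Group G] [Finite G] (ξ : ℂ) : Type _ := repRing G ⊗[ℤ] ZXi ξ

/-- Virtual characters viewed as functions `Cl(G) → ℤ[ξ]`. -/
noncomputable def repRingToFun {G : Type*} [Group G] [Finite G] {ξ : ℂ}
    (hξ : IsPrimitiveRoot ξ (Nat.card G)) : repRing G →+* (ConjClasses G → ZXi ξ) where
  toFun χ c := ⟨(χ : ConjClasses G → ℂ) c, repRing_apply_mem hξ χ c⟩
  map_one' := rfl
  map_mul' _ _ := rfl
  map_zero' := rfl
  map_add' _ _ := rfl

/-- The canonical map `R(G) ⊗_ℤ ℤ[ξ] → ℤ[ξ]^{Cl(G)}`, `χ ⊗ a ↦ (c ↦ χ(c) a)`. -/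
noncomputable def rbarToFun {G : Type*} [Group G] [Finite G] {ξ : ℂ}
    (hξ : IsPrimitiveRoot ξ (Nat.card G)) : RBar G ξ →+* (ConjClasses G → ZXi ξ) :=
  (Algebra.TensorProduct.productMap (repRingToFun hξ).toIntAlgHom
    (Pi.constAlgHom ℤ (ConjClasses G) (ZXi ξ))).toRingHom

/-- The affine scheme `C = Spec (R(G) ⊗_ℤ ℤ[ξ])`. -/
noncomputable abbrev specRBar (G : Type*) [Group G] [Finite G] (ξ : ℂ) :
    AlgebraicGeometry.Scheme :=
  AlgebraicGeometry.Spec (CommRingCat.of (RBar G ξ))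

/-- The prime `Q_c = {f : Cl(G) → ℤ[ξ] | f(c) ∈ Q}` of `ℤ[ξ]^{Cl(G)}`. -/
def primeAbove {G : Type*} [Group G] {ξ : ℂ} (Q : PrimeSpectrum (ZXi ξ)) (c : ConjClasses G) :
    PrimeSpectrum (ConjClasses G → ZXi ξ) :=
  PrimeSpectrum.comap (Pi.evalRingHom (fun _ : ConjClasses G => ZXi ξ) c) Q

/-- The point `P` of `C` given by the contraction of the prime `Q_c` of `ℤ[ξ]^{Cl(G)}` to
`R(G) ⊗_ℤ ℤ[ξ]`. -/
noncomputable def point {G : Type*} [Group G] [Finite G] {ξ : ℂ}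
    (hξ : IsPrimitiveRoot ξ (Nat.card G)) (Q : PrimeSpectrum (ZXi ξ)) (c : ConjClasses G) :
    specRBar G ξ :=
  PrimeSpectrum.comap (rbarToFun hξ) (primeAbove Q c)

/-- A point of a scheme is singular if its local ring is not regular, that is (for a Noetherian
local ring), if the embedding dimension differs from the Krull dimension. -/
def IsSingularPoint (X : AlgebraicGeometry.Scheme) (x : X) : Prop :=
  ¬ IsRegularLocalRing (X.presheaf.stalk x)

/-- `r` is the `p`-regular part of `g`: we have `g = u * r` with `u` and `r` powers of `g`, where
the order of `u` is a power of `p` and the order of `r` is not divisible by `p`. -/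
def IsRegularPart {G : Type*} [Group G] (p : ℕ) (g r : G) : Prop :=
  ¬ p ∣ orderOf r ∧ r ∈ Subgroup.zpowers g ∧
    ∃ u ∈ Subgroup.zpowers g, g = u * r ∧ ∃ k : ℕ, orderOf u = p ^ k

/-- The set of the `p`-regular parts of the elements of a conjugacy class. -/
def regularPart {G : Type*} [Group G] (p : ℕ) (c : ConjClasses G) : Set G :=
  {r | ∃ g ∈ c.carrier, IsRegularPart p g r}

end RepSpec

open RepSpec
open scoped TensorProduct

/-! Write `O = ℤ[ξ]` and `A = R(G) ⊗ O`. The evaluations `φ_c : A → O` are finitely many distinct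
`O`-algebra maps, and they are jointly injective because the irreducible characters are linearly
independent. Hence the minimal primes of `A` are the kernels `ker φ_c`, each component of `Spec A`
is a copy of `Spec O`, and `P = φ_c⁻¹(Q)`.

If no other kernel lies in `P`, then `A_P ≅ O_Q`, which is regular since `O` is Dedekind.
Conversely, `A_P` has dimension at most one, so regularity makes it a domain and leaves room for a
single minimal prime below `P`. Thus (i) and (ii) both say that `ker φ_d ≤ P` for some `d ≠ c`, that
is, `φ_d ≡ φ_c` modulo `Q` (`isRegularLocalRing_localization_comap_iff`,
`exists_two_irreducibleComponents_iff`).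

It remains to decide when two classes are congruent (`forall_rbarToFun_sub_mem_iff`). Modulo `Q ≠ 0`
of residue characteristic `p`, `p`-power roots of unity become `1`, so a character takes congruent
values at `g` and at its `p`-regular part. Distinct `p`-regular classes are separated by a
fixed-point count on `G ⧸ P`, now with `P` a Sylow `p`-subgroup of the centralizer of `x`: its value
at `x` is the index of `P` there, prime to `p`, and it vanishes at the other `p`-regular classes.
For `Q = 0` the same count with trivial `P` separates all classes. -/

/-- A regular local ring of Krull dimension at most one is a domain. -/
lemma IsRegularLocalRing.isDomain_of_ringKrullDim_le_one (B : Type*) [CommRing B]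
    [IsRegularLocalRing B] (hB : ringKrullDim B ≤ 1) : IsDomain B := by
  have hspan := IsRegularLocalRing.spanFinrank_maximalIdeal (R := B)
  have hle : (IsLocalRing.maximalIdeal B).spanFinrank ≤ 1 := by
    rw [← hspan] at hB
    exact_mod_cast hB
  obtain ⟨q, hq, -⟩ := Ideal.exists_minimalPrimes_le (bot_le : (⊥ : Ideal B) ≤
    IsLocalRing.maximalIdeal B)
  have hqp : q.IsPrime := hq.1.1
  have hqm : q ≤ IsLocalRing.maximalIdeal B := IsLocalRing.le_maximalIdeal hqp.ne_top
  suffices hq0 : q = ⊥ by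
    subst hq0
    exact IsDomain.of_bot_isPrime B
  by_cases hqeq : q = IsLocalRing.maximalIdeal B
  · have hh : (IsLocalRing.maximalIdeal B).height = 0 := by
      rw [← hqeq]
      exact Ideal.height_eq_zero_iff.mpr hq
    rw [← IsLocalRing.maximalIdeal_height_eq_ringKrullDim, hh] at hspan
    have h0 : (IsLocalRing.maximalIdeal B).spanFinrank = 0 := by exact_mod_cast hspan
    rw [hqeq]
    exact (Submodule.spanFinrank_eq_zero_iff_eq_bot (IsNoetherian.noetherian _)).mp h0
  · have hprin : (IsLocalRing.maximalIdeal B).IsPrincipal := by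
      rcases Nat.le_one_iff_eq_zero_or_eq_one.mp hle with h | h
      · rw [(Submodule.spanFinrank_eq_zero_iff_eq_bot (IsNoetherian.noetherian _)).mp h]
        infer_instance
      · exact ((Submodule.spanFinrank_eq_one_iff _).mp h).1
    obtain ⟨t, ht⟩ := hprin
    -- Since `t ∉ q`, each multiple of `t` in `q` is `t` times an element of `q`. So `q = 𝔪 q`, and
    -- Nakayama gives `q = 0`.
    have htq : t ∉ q := fun h => hqeq (le_antisymm hqm (by
      rw [ht, Submodule.span_singleton_le_iff_mem]; exact h))
    apply Submodule.eq_bot_of_le_smul_of_le_jacobson_bot (IsLocalRing.maximalIdeal B) q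
      (IsNoetherian.noetherian _)
    · intro x hx
      have hxm := hqm hx
      rw [ht] at hxm
      obtain ⟨y, rfl⟩ := Submodule.mem_span_singleton.mp hxm
      rw [smul_eq_mul] at hx ⊢
      have hy : y ∈ q := (hqp.mem_or_mem hx).resolve_right htq
      rw [show y • t = t * y from mul_comm y t]
      refine Ideal.mul_mem_mul ?_ hy
      rw [ht]
      exact Submodule.mem_span_singleton_self t
    · exact IsLocalRing.maximalIdeal_le_jacobson _

/-! ### Rings with finitely many jointly injective retractions onto a domain. -/

section Evaluations

variable {O A ι : Type*} [CommRing O] [CommRing A] [Algebra O A]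

/-- Since `φ` retracts the structure map, `ker φ` consists exactly of the elements `a - φ a`, and
`ψ` sends these to `ψ a - φ a`. -/
lemma ker_le_comap_iff (φ ψ : A →ₐ[O] O) (Q : Ideal O) :
    RingHom.ker φ ≤ Q.comap ψ ↔ ∀ a, φ a - ψ a ∈ Q := by
  constructor
  · intro h a
    have : a - algebraMap O A (φ a) ∈ RingHom.ker φ := by
      rw [RingHom.mem_ker, map_sub, AlgHom.commutes, Algebra.algebraMap_self_apply, sub_self]
    have := h this
    rw [Ideal.mem_comap, map_sub, AlgHom.commutes, Algebra.algebraMap_self_apply] at this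
    rw [← neg_sub]
    exact neg_mem this
  · intro h a ha
    have := h a
    rw [RingHom.mem_ker.mp ha, zero_sub] at this
    rw [Ideal.mem_comap]
    simpa using neg_mem this

lemma ker_le_ker_iff (φ ψ : A →ₐ[O] O) : RingHom.ker φ ≤ RingHom.ker ψ ↔ φ = ψ := by
  have := ker_le_comap_iff φ ψ ⊥
  rw [show Ideal.comap ψ ⊥ = RingHom.ker ψ from rfl] at this
  rw [this]
  constructor
  · intro h
    ext a
    exact sub_eq_zero.mp (h a)
  · rintro rfl a
    simp

variable [Finite ι]

lemma exists_ker_le (φ : ι → A →ₐ[O] O)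
    (hinj : ∀ a, (∀ i, φ i a = 0) → a = 0)
    (q : Ideal A) [q.IsPrime] : ∃ i, RingHom.ker (φ i) ≤ q := by
  have := Fintype.ofFinite ι
  have h : (Finset.univ.inf fun i => RingHom.ker (φ i)) ≤ q := by
    intro a ha
    rw [hinj a]
    · exact zero_mem _
    · intro i
      exact (Finset.inf_le (f := fun i => RingHom.ker (φ i)) (Finset.mem_univ i)) ha
  obtain ⟨i, -, hi⟩ := (Ideal.IsPrime.inf_le' ‹_›).mp h
  exact ⟨i, hi⟩

/-- The kernels intersect in zero, so every prime contains one of them; by `ker_le_ker_iff` no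
kernel lies strictly inside another. -/
lemma minimalPrimes_eq_range_ker [IsDomain O] (φ : ι → A →ₐ[O] O)
    (hinj : ∀ a, (∀ i, φ i a = 0) → a = 0) :
    minimalPrimes A = Set.range fun i => RingHom.ker (φ i) := by
  ext q
  constructor
  · intro hq
    have : q.IsPrime := hq.1.1
    obtain ⟨i, hi⟩ := exists_ker_le φ hinj q
    exact ⟨i, le_antisymm hi (hq.2 ⟨RingHom.ker_isPrime _, bot_le⟩ hi)⟩
  · rintro ⟨i, rfl⟩
    refine ⟨⟨RingHom.ker_isPrime _, bot_le⟩, fun r hr hri => ?_⟩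
    have : r.IsPrime := hr.1
    obtain ⟨j, hj⟩ := exists_ker_le φ hinj r
    have := (ker_le_ker_iff _ _).mp (hj.trans hri)
    change RingHom.ker (φ i) ≤ r
    rw [← this]
    exact hj

/-- Any prime contains some `ker φ_i`, and `A / ker φ_i ≅ O` has dimension at most one. -/
lemma ringKrullDim_le_one_of_jointly_injective [IsDomain O] [Ring.DimensionLEOne O]
    (φ : ι → A →ₐ[O] O)
    (hinj : ∀ a, (∀ i, φ i a = 0) → a = 0) :
    ringKrullDim A ≤ 1 := by
  have : Ring.KrullDimLE 1 A := by
    refine Ring.KrullDimLE.mk₁ fun I hI => ?_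
    obtain ⟨i, hi⟩ := exists_ker_le φ hinj I
    by_cases h : RingHom.ker (φ i) = I
    · left
      rw [minimalPrimes_eq_range_ker φ hinj]
      exact ⟨i, h⟩
    · right
      have hsurj : Function.Surjective (φ i) := fun a =>
        ⟨algebraMap O A a, by rw [AlgHom.commutes, Algebra.algebraMap_self_apply]⟩
      have hI' : (I.map (φ i)).IsPrime := Ideal.map_isPrime_of_surjective hsurj hi
      have hcomap : (I.map (φ i)).comap (φ i) = I := by
        rw [Ideal.comap_map_of_surjective' _ hsurj, sup_eq_left]
        exact hi
      have hne : I.map (φ i) ≠ ⊥ := by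
        intro h0
        rw [Ideal.map_eq_bot_iff_le_ker] at h0
        exact h (le_antisymm hi h0)
      have := hI'.isMaximal hne
      rw [← hcomap]
      exact Ideal.comap_isMaximal_of_surjective _ hsurj
  exact (Order.krullDimLE_iff 1 _).mp this

lemma isLocalization_atPrime_of_unique [IsDomain O] (φ : ι → A →ₐ[O] O)
    (hinj : ∀ a, (∀ i, φ i a = 0) → a = 0)
    (i : ι) (Q : Ideal O) [Q.IsPrime]
    (huniq : ∀ j, RingHom.ker (φ j) ≤ Q.comap (φ i) → j = i) (B : Type*) [CommRing B]
    [Algebra O B] [IsLocalization.AtPrime B Q] :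
    letI := ((algebraMap O B).comp (φ i : A →+* O)).toAlgebra
    IsLocalization.AtPrime B (Q.comap (φ i)) := by
  let := ((algebraMap O B).comp (φ i : A →+* O)).toAlgebra
  have hmap (a : A) : algebraMap A B a = algebraMap O B (φ i a) := rfl
  refine ⟨⟨?_, ?_, ?_⟩⟩
  · rintro ⟨s, hs⟩
    exact IsLocalization.map_units B (⟨φ i s, hs⟩ : Q.primeCompl)
  · intro z
    obtain ⟨⟨x, s⟩, hx⟩ := IsLocalization.surj Q.primeCompl z
    have hφ (x : O) : φ i (algebraMap O A x) = x := by
      rw [AlgHom.commutes, Algebra.algebraMap_self_apply]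
    refine ⟨(algebraMap O A x, ⟨algebraMap O A s, ?_⟩), ?_⟩
    · change φ i (algebraMap O A s) ∉ Q
      rw [hφ]
      exact s.2
    · simp only [hmap, hφ]
      exact hx
  · intro a b hab
    have hab' : φ i a = φ i b := by
      rw [hmap, hmap] at hab
      exact IsLocalization.injective B Q.primeCompl_le_nonZeroDivisors hab
    -- By prime avoidance for the finite intersection of the other kernels. Multiplying by `s` kills
    -- every coordinate but the `i`-th, where `a` and `b` already agree.
    have hex : ∃ s : A, s ∉ Q.comap (φ i) ∧ ∀ j, j ≠ i → φ j s = 0 := by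
      have := Fintype.ofFinite ι
      classical
      have hn : ¬ ((Finset.univ.erase i).inf fun j => RingHom.ker (φ j)) ≤ Q.comap (φ i) := by
        intro h
        obtain ⟨j, hj, hj'⟩ := (Ideal.IsPrime.inf_le' inferInstance).mp h
        exact (Finset.ne_of_mem_erase hj) (huniq j hj')
      obtain ⟨s, hs, hs'⟩ := SetLike.not_le_iff_exists.mp hn
      refine ⟨s, hs', fun j hj => ?_⟩
      exact (Finset.inf_le (f := fun j => RingHom.ker (φ j))
        (Finset.mem_erase.mpr ⟨hj, Finset.mem_univ j⟩)) hs
    obtain ⟨s, hs, hs'⟩ := hex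
    refine ⟨⟨s, hs⟩, sub_eq_zero.mp (hinj _ fun j => ?_)⟩
    change φ j (s * a - s * b) = 0
    rw [map_sub, map_mul, map_mul]
    by_cases hj : j = i
    · rw [hj, hab', sub_self]
    · rw [hs' j hj, zero_mul, zero_mul, sub_self]

/-- The local ring at the pullback of a prime under one of finitely many jointly injective
evaluations with values in a Dedekind domain is regular if and only if this point does not lie
over the kernel of another evaluation. -/
lemma isRegularLocalRing_localization_comap_iff [IsDedekindDomain O] [IsNoetherianRing A]
    (φ : ι → A →ₐ[O] O)
    (hinj : ∀ a, (∀ i, φ i a = 0) → a = 0)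
    (hφ : Function.Injective φ) (i : ι) (Q : Ideal O) [Q.IsPrime] :
    IsRegularLocalRing (Localization.AtPrime (Q.comap (φ i))) ↔
      ∀ j, RingHom.ker (φ j) ≤ Q.comap (φ i) → j = i := by
  constructor
  · intro hreg j hj
    set P := Q.comap (φ i)
    have hdim : ringKrullDim (Localization.AtPrime P) ≤ 1 := by
      rw [IsLocalization.AtPrime.ringKrullDim_eq_height P]
      exact (Ideal.height_le_ringKrullDim_of_ne_top Ideal.IsPrime.ne_top').trans
        (ringKrullDim_le_one_of_jointly_injective φ hinj)
    have := IsRegularLocalRing.isDomain_of_ringKrullDim_le_one _ hdim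
    -- The kernel of localization is prime, as the local ring is a domain, and lies below every
    -- minimal prime contained in `P`; minimality forces equality.
    have hker (k : ι) (hk : RingHom.ker (φ k) ≤ P) :
        RingHom.ker (φ k) = RingHom.ker (algebraMap A (Localization.AtPrime P)) := by
      have hmem : RingHom.ker (φ k) ∈ minimalPrimes A := by
        rw [minimalPrimes_eq_range_ker φ hinj]
        exact ⟨k, rfl⟩
      have hle : RingHom.ker (algebraMap A (Localization.AtPrime P)) ≤ RingHom.ker (φ k) := by
        intro a ha
        obtain ⟨s, hs⟩ := (IsLocalization.map_eq_zero_iff P.primeCompl _ a).mp ha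
        have : φ k (s * a) = 0 := by rw [hs, map_zero]
        rw [map_mul] at this
        exact (mul_eq_zero.mp this).resolve_left fun h => s.2 (hk h)
      exact le_antisymm (hmem.2 ⟨RingHom.ker_isPrime _, bot_le⟩ hle) hle
    have hi : RingHom.ker (φ i) ≤ P := fun a ha => by
      rw [Ideal.mem_comap, RingHom.mem_ker.mp ha]
      exact zero_mem _
    exact hφ ((ker_le_ker_iff _ _).mp ((hker j hj).trans (hker i hi).symm).le)
  · intro huniq
    let := ((algebraMap O (Localization.AtPrime Q)).comp (φ i : A →+* O)).toAlgebra
    have : IsLocalization.AtPrime (Localization.AtPrime Q) (Q.comap (φ i)) :=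
      isLocalization_atPrime_of_unique φ hinj i Q huniq _
    have hQ : IsRegularLocalRing (Localization.AtPrime Q) := inferInstance
    exact IsRegularLocalRing.of_ringEquiv (IsLocalization.algEquiv (Q.comap (φ i)).primeCompl
      (Localization.AtPrime Q) (Localization.AtPrime (Q.comap (φ i)))).toRingEquiv

end Evaluations

/-! ### Traces through eigenspaces of operators of finite order. -/

section Eigen

variable {V : Type*} [AddCommGroup V] [Module ℂ V]

lemma iSup_eigenspace_eq_top_of_pow_eq_one [FiniteDimensional ℂ V] {T : Module.End ℂ V} {n : ℕ} (hn : n ≠ 0)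
    (hT : T ^ n = 1) : ⨆ μ, T.eigenspace μ = ⊤ := by
  apply Module.End.IsSemisimple.iSup_eigenspace_eq_top
  refine Module.End.isSemisimple_of_squarefree_aeval_eq_zero (p := Polynomial.X ^ n - 1) ?_ ?_
  · exact (Polynomial.separable_X_pow_sub_C (1 : ℂ) (by exact_mod_cast hn)
      one_ne_zero).squarefree
  · simp [hT]

lemma mapsTo_eigenspace_of_commute {T S : Module.End ℂ V} (h : Commute S T) (μ : ℂ) :
    Set.MapsTo S (T.eigenspace μ) (T.eigenspace μ) := by
  intro v hv
  rw [SetLike.mem_coe, Module.End.mem_eigenspace_iff] at hv ⊢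
  rw [← Module.End.mul_apply, ← h.eq, Module.End.mul_apply, hv, map_smul]

/-- If `T` has finite order and `S` commutes with `T`, the traces of all `S * T ^ j` are obtained
from the traces of `S` on the eigenspaces of `T`. -/
lemma exists_trace_mul_pow_eq_sum [FiniteDimensional ℂ V] {T : Module.End ℂ V} {n : ℕ} (hn : n ≠ 0) (hT : T ^ n = 1) :
    ∃ s : Finset ℂ, (∀ μ ∈ s, μ ^ n = 1) ∧
      ∀ (S : Module.End ℂ V) (h : Commute S T) (j : ℕ),
        LinearMap.trace ℂ V (S * T ^ j) = ∑ μ ∈ s, μ ^ j *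
          LinearMap.trace ℂ _ (S.restrict (mapsTo_eigenspace_of_commute h μ)) := by
  classical
  have hint : DirectSum.IsInternal T.eigenspace :=
    DirectSum.isInternal_submodule_of_iSupIndep_of_iSup_eq_top T.eigenspaces_iSupIndep
      (iSup_eigenspace_eq_top_of_pow_eq_one hn hT)
  have hfin := WellFoundedGT.finite_ne_bot_of_iSupIndep T.eigenspaces_iSupIndep
  refine ⟨hfin.toFinset, ?_, ?_⟩
  · intro μ hμ
    rw [Set.Finite.mem_toFinset, Set.mem_ofPred_eq] at hμ
    obtain ⟨v, hv, hv0⟩ := Submodule.exists_mem_ne_zero_of_ne_bot hμ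
    have hpow := (Module.End.HasEigenvector.pow_apply ⟨hv, hv0⟩ n : (T ^ n) v = μ ^ n • v)
    rw [hT, Module.End.one_apply] at hpow
    have : (μ ^ n - 1) • v = 0 := by rw [sub_smul, one_smul, ← hpow, sub_self]
    exact sub_eq_zero.mp ((smul_eq_zero.mp this).resolve_right hv0)
  · intro S h j
    rw [LinearMap.trace_eq_sum_trace_restrict' hint hfin
      (mapsTo_eigenspace_of_commute ((h.mul_left (Commute.pow_self T j))))]
    refine Finset.sum_congr rfl fun μ _ => ?_
    have hTj (v : V) (hv : v ∈ T.eigenspace μ) : (T ^ j) v = μ ^ j • v := by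
      rw [Module.End.mem_eigenspace_iff] at hv
      induction j with
      | zero => simp
      | succ k ih => rw [pow_succ, Module.End.mul_apply, hv, map_smul, ih, smul_smul, pow_succ']
    have hres : (S * T ^ j).restrict (mapsTo_eigenspace_of_commute
        (h.mul_left (Commute.pow_self T j)) μ) =
          μ ^ j • S.restrict (mapsTo_eigenspace_of_commute h μ) := by
      ext ⟨v, hv⟩
      change S ((T ^ j) v) = μ ^ j • S v
      rw [hTj v hv, map_smul]
    refine (congrArg _ hres).trans ?_
    rw [map_smul, smul_eq_mul]

end Eigen

/-! ### Constructing elements of `R(G) ⊗ ℤ[ξ]`, and congruences for their values. -/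

section Span

variable {G : Type*} [Group G] [Finite G] {ξ : ℂ}

lemma mem_ZXi_of_pow_eq_one (hξ : IsPrimitiveRoot ξ (Nat.card G)) {μ : ℂ}
    (hμ : μ ^ Nat.card G = 1) : μ ∈ ZXi ξ := by
  have : NeZero (Nat.card G) := ⟨Nat.card_pos.ne'⟩
  obtain ⟨i, -, rfl⟩ := hξ.eq_pow_of_pow_eq_one hμ
  exact pow_mem (Algebra.subset_adjoin (Set.mem_singleton ξ)) i

/-- The eigenspaces of `T` are subrepresentations and its eigenvalues lie in `ℤ[ξ]`; the element is
the sum of their characters weighted by the eigenvalues. -/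
lemma exists_rbarToFun_eq_of_commute (hξ : IsPrimitiveRoot ξ (Nat.card G)) {V : Type}
    [AddCommGroup V] [Module ℂ V] [FiniteDimensional ℂ V] (ρ : Representation ℂ G V)
    (T : Module.End ℂ V) (hT : T ^ Nat.card G = 1) (hcomm : ∀ g, Commute (ρ g) T) :
    ∃ a : RBar G ξ, ∀ g : G,
      (rbarToFun hξ a (ConjClasses.mk g) : ℂ) = LinearMap.trace ℂ V (ρ g * T) := by
  obtain ⟨s, hs, hsum⟩ := exists_trace_mul_pow_eq_sum Nat.card_pos.ne' hT
  let W (μ : ℂ) : Subrepresentation ρ :=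
    ⟨T.eigenspace μ, fun g v hv => mapsTo_eigenspace_of_commute (hcomm g) μ hv⟩
  let χ (μ : ℂ) : repRing G := ⟨classChar (W μ).toRepresentation, classChar_mem _ _ rfl⟩
  refine ⟨∑ μ ∈ s.attach, χ μ ⊗ₜ (⟨μ, mem_ZXi_of_pow_eq_one hξ (hs μ μ.2)⟩ : ZXi ξ), fun g => ?_⟩
  have := hsum (ρ g) (hcomm g) 1
  rw [pow_one] at this
  rw [this, map_sum, Finset.sum_apply, AddSubmonoidClass.coe_finsetSum, ← Finset.sum_attach s]
  refine Finset.sum_congr rfl fun μ _ => ?_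
  rw [pow_one, mul_comm]
  rfl

/-- For commuting permutation actions of `G` and of a permutation `τ` whose order divides `|G|`,
the function counting the fixed points of `g` followed by `τ` is a `ℤ[ξ]`-linear combination
of characters. -/
lemma exists_rbarToFun_eq_card_fixed (hξ : IsPrimitiveRoot ξ (Nat.card G)) {X : Type*} [Finite X]
    [MulAction G X] (τ : Equiv.Perm X) (hτ : τ ^ Nat.card G = 1)
    (hcomm : ∀ (g : G) x, τ (g • x) = g • τ x) :
    ∃ a : RBar G ξ, ∀ g : G,
      (rbarToFun hξ a (ConjClasses.mk g) : ℂ) = Nat.card {x : X // g • τ x = x} := by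
  classical
  -- The permutation representation is built on `Fin m` because the representation space must lie in
  -- `Type`, while `X` may live in any universe.
  obtain ⟨m, ⟨e⟩⟩ := Finite.exists_equiv_fin X
  let L : Equiv.Perm X →* Module.End ℂ (Fin m → ℂ) :=
    { toFun := fun σ => LinearMap.funLeft ℂ ℂ fun i => e (σ⁻¹ (e.symm i))
      map_one' := by ext; simp
      map_mul' := fun σ σ' => by
        ext f i
        simp [LinearMap.funLeft_apply, Equiv.Perm.mul_apply] }
  have htr (σ : Equiv.Perm X) :
      LinearMap.trace ℂ _ (L σ) = Nat.card {x : X // σ x = x} := by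
    rw [LinearMap.trace_eq_matrix_trace ℂ (Pi.basisFun ℂ (Fin m)), Matrix.trace]
    have : Fintype X := Fintype.ofFinite X
    have h1 (i : Fin m) : Matrix.diag (LinearMap.toMatrix (Pi.basisFun ℂ (Fin m))
        (Pi.basisFun ℂ (Fin m)) (L σ)) i = if σ (e.symm i) = e.symm i then 1 else 0 := by
      rw [Matrix.diag_apply, LinearMap.toMatrix_apply]
      simp only [Pi.basisFun_apply, Pi.basisFun_repr]
      change (Pi.single i 1 : Fin m → ℂ) (e (σ⁻¹ (e.symm i))) = _
      rw [Pi.single_apply]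
      congr 1
      rw [← Equiv.eq_symm_apply, Equiv.Perm.inv_eq_iff_eq]
      exact propext eq_comm
    rw [Finset.sum_congr rfl fun i _ => h1 i, Nat.card_eq_fintype_card, Fintype.card_subtype,
      Finset.sum_boole, ← Finset.card_map e.symm.toEmbedding]
    congr 2
    ext x
    simp
  have hLcomm (g : G) : Commute (MulAction.toPermHom G X g) τ := by
    ext x
    exact (hcomm g x).symm
  obtain ⟨a, ha⟩ := exists_rbarToFun_eq_of_commute hξ (L.comp (MulAction.toPermHom G X)) (L τ)
    (by rw [← map_pow, hτ, map_one]) (fun g => (hLcomm g).map L)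
  refine ⟨a, fun g => ?_⟩
  rw [ha, MonoidHom.comp_apply, ← map_mul, htr]
  rfl

/-- If every `|G|`-th root of unity `μ` satisfies `μ ≡ μ ^ e` modulo `I`, then
`χ(g) ≡ χ(g ^ e)` modulo `I`. -/
lemma rbarToFun_sub_pow_mem (hξ : IsPrimitiveRoot ξ (Nat.card G)) (I : Ideal (ZXi ξ)) (e : ℕ)
    (hI : ∀ μ : ZXi ξ, μ ^ Nat.card G = 1 → μ - μ ^ e ∈ I) (a : RBar G ξ) (g : G) :
    rbarToFun hξ a (ConjClasses.mk g) - rbarToFun hξ a (ConjClasses.mk (g ^ e)) ∈ I := by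
  have hχ (χ : repRing G) :
      repRingToFun hξ χ (ConjClasses.mk g) - repRingToFun hξ χ (ConjClasses.mk (g ^ e)) ∈ I := by
    obtain ⟨χ, hχ⟩ := χ
    change χ ∈ AddSubgroup.closure (irrChars G) at hχ
    induction hχ using AddSubgroup.closure_induction with
    | zero =>
      convert I.zero_mem
      exact sub_self _
    | add x y hx hy h1 h2 =>
      rw [show (⟨x + y, add_mem hx hy⟩ : repRing G) = ⟨x, hx⟩ + ⟨y, hy⟩ from rfl, map_add,
        Pi.add_apply, Pi.add_apply, add_sub_add_comm]
      exact I.add_mem h1 h2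
    | neg x hx h =>
      rw [show (⟨-x, neg_mem hx⟩ : repRing G) = -⟨x, hx⟩ from rfl, map_neg,
        Pi.neg_apply, Pi.neg_apply, neg_sub_neg, ← neg_sub]
      exact I.neg_mem h
    | mem x hx =>
      obtain ⟨V, _, _, _, ρ, -, rfl⟩ := hx
      obtain ⟨s, hs, hsum⟩ := exists_trace_mul_pow_eq_sum (T := ρ g) Nat.card_pos.ne'
        (by rw [← map_pow, pow_card_eq_one', map_one])
      -- With `S = 1` the restricted traces are the multiplicities of the eigenvalues, so passing
      -- from `g` to `g ^ e` only replaces each `μ` by `μ ^ e`.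
      have hj (j : ℕ) : classChar ρ (ConjClasses.mk (g ^ j)) = ∑ μ ∈ s, μ ^ j *
          (Module.finrank ℂ (Module.End.eigenspace (ρ g) μ) : ℂ) := by
        change LinearMap.trace ℂ V (ρ (g ^ j)) = _
        have := hsum 1 (Commute.one_left _) j
        rw [one_mul] at this
        rw [map_pow, this]
        refine Finset.sum_congr rfl fun μ _ => ?_
        rw [← LinearMap.trace_one]
        rfl
      have hmem : ∑ μ ∈ s.attach, ((⟨μ, mem_ZXi_of_pow_eq_one hξ (hs μ μ.2)⟩ : ZXi ξ) -
          ⟨μ, mem_ZXi_of_pow_eq_one hξ (hs μ μ.2)⟩ ^ e) *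
          (Module.finrank ℂ (Module.End.eigenspace (ρ g) μ) : ZXi ξ) ∈ I := by
        refine Ideal.sum_mem _ fun μ _ => I.mul_mem_right _ (hI _ ?_)
        ext
        exact hs μ μ.2
      convert hmem using 1
      ext
      rw [AddSubmonoidClass.coe_finsetSum]
      change classChar ρ _ - classChar ρ _ = ∑ μ ∈ s.attach, ((μ : ℂ) - μ ^ e) *
        (((Module.finrank ℂ (Module.End.eigenspace (ρ g) μ) : ℕ) : ZXi ξ) : ℂ)
      rw [Finset.sum_attach s fun μ => (μ - μ ^ e) *
        (((Module.finrank ℂ (Module.End.eigenspace (ρ g) μ) : ℕ) : ZXi ξ) : ℂ), hj e]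
      have := hj 1
      rw [pow_one] at this
      rw [this, ← Finset.sum_sub_distrib]
      refine Finset.sum_congr rfl fun μ _ => ?_
      rw [pow_one, sub_mul]
      rfl
  induction a using TensorProduct.induction_on with
  | zero => simp
  | add x y h1 h2 =>
    rw [map_add, Pi.add_apply, Pi.add_apply, add_sub_add_comm]
    exact I.add_mem h1 h2
  | tmul χ z =>
    change repRingToFun hξ χ _ * z - repRingToFun hξ χ _ * z ∈ I
    rw [← sub_mul]
    exact I.mul_mem_right _ (hχ χ)

end Span

/-! ### Separating classes by counting fixed cosets. -/

section Separation

variable {G : Type*} [Group G] [Finite G] {ξ : ℂ}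

/-- Let `P` be a subgroup of the centralizer of `x`. There is an element of `R(G) ⊗ ℤ[ξ]` whose
value at `x` is the index of `P` in the centralizer, provided that `x` has no conjugates in `P x`
other than `x`, and which vanishes at all elements without conjugates in `P x`. -/
lemma exists_rbarToFun_centralizer (hξ : IsPrimitiveRoot ξ (Nat.card G)) (x : G) (P : Subgroup G)
    (hP : P ≤ Subgroup.centralizer {x})
    (hx : ∀ y : G, y⁻¹ * x * y * x⁻¹ ∈ P → y ∈ Subgroup.centralizer {x}) :
    ∃ a : RBar G ξ, ∃ k : ℕ,
      k * Nat.card P = Nat.card (Subgroup.centralizer {x}) ∧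
      rbarToFun hξ a (ConjClasses.mk x) = k ∧
      ∀ s : G, (∀ y : G, y⁻¹ * s * y * x⁻¹ ∉ P) → rbarToFun hξ a (ConjClasses.mk s) = 0 := by
  have hxn : x⁻¹ ∈ Subgroup.normalizer (P : Set G) := by
    refine inv_mem (Subgroup.mem_normalizer_iff.mpr fun h => ?_)
    constructor
    · intro hh
      rwa [← Subgroup.mem_centralizer_singleton_iff.mp (hP hh), mul_inv_cancel_right]
    · intro hh
      have := Subgroup.mem_centralizer_singleton_iff.mp (hP hh)
      have h' : x * h * x⁻¹ = h := by
        calc x * h * x⁻¹ = x⁻¹ * ((x * h * x⁻¹) * x) := by rw [this]; group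
          _ = h := by group
      rwa [h'] at hh
  -- Right multiplication by `x⁻¹` descends to `G ⧸ P` because `x` centralizes, hence normalizes,
  -- `P`; it commutes with left translation.
  let w : (Subgroup.normalizer (P : Set G)).op := ⟨MulOpposite.op x⁻¹, hxn⟩
  let τ : Equiv.Perm (G ⧸ P) := MulAction.toPermHom _ (G ⧸ P) w
  have hτmk (y : G) : τ (y : G ⧸ P) = ((y * x⁻¹ : G) : G ⧸ P) := rfl
  have hτ : τ ^ Nat.card G = 1 := by
    have hw : w ^ Nat.card G = 1 := by
      ext
      change (MulOpposite.op x⁻¹) ^ Nat.card G = 1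
      rw [← MulOpposite.op_pow, pow_card_eq_one', MulOpposite.op_one]
    rw [← map_pow, hw, map_one]
  obtain ⟨a, ha⟩ := exists_rbarToFun_eq_card_fixed hξ τ hτ (by
    intro g y
    induction y using QuotientGroup.induction_on with
    | H y =>
      rw [hτmk, MulAction.Quotient.smul_coe, MulAction.Quotient.smul_coe, hτmk, smul_eq_mul,
        smul_eq_mul, mul_assoc])
  have hfix (g y : G) : g • τ (y : G ⧸ P) = (y : G ⧸ P) ↔ y⁻¹ * g * y * x⁻¹ ∈ P := by
    rw [hτmk, MulAction.Quotient.smul_coe, eq_comm, QuotientGroup.eq, smul_eq_mul, mul_assoc,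
      mul_assoc]
  refine ⟨a, Nat.card {y : G ⧸ P // x • τ y = y}, ?_, ?_, ?_⟩
  -- For `g = x` the coset of `y` is fixed exactly when `y` centralizes `x`, so the union of the
  -- fixed cosets is the centralizer.
  · rw [mul_comm, ← Nat.card_prod]
    refine (Nat.card_congr (QuotientGroup.preimageMkEquivSubgroupProdSet P
      {y : G ⧸ P | x • τ y = y})).symm.trans
      (Nat.card_congr (Equiv.subtypeEquivRight fun y => ?_))
    constructor
    · intro h
      exact hx y ((hfix x y).mp h)
    · intro h
      refine (hfix x y).mpr ?_
      rw [mul_assoc _ x, ← Subgroup.mem_centralizer_singleton_iff.mp h]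
      simp
  · ext
    rw [ha]
    simp
  · intro s hs
    ext
    rw [ha]
    have : IsEmpty {y : G ⧸ P // s • τ y = y} := by
      refine ⟨fun ⟨y, hy⟩ => ?_⟩
      induction y using QuotientGroup.induction_on with
      | H y => exact hs y ((hfix s y).mp hy)
    simp

/-- An element of `R(G) ⊗ ℤ[ξ]` which vanishes outside of a given conjugacy class. -/
lemma exists_rbarToFun_ne_zero (hξ : IsPrimitiveRoot ξ (Nat.card G)) (x : G) :
    ∃ a : RBar G ξ, rbarToFun hξ a (ConjClasses.mk x) ≠ 0 ∧
      ∀ s : G, ¬ IsConj s x → rbarToFun hξ a (ConjClasses.mk s) = 0 := by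
  have hmem (s y : G) : y⁻¹ * s * y * x⁻¹ ∈ (⊥ : Subgroup G) ↔ y⁻¹ * s * y = x := by
    rw [Subgroup.mem_bot, mul_inv_eq_one]
  obtain ⟨a, k, hk, h1, h2⟩ := exists_rbarToFun_centralizer hξ x ⊥ bot_le (by
    intro y hy
    rw [hmem] at hy
    rw [Subgroup.mem_centralizer_singleton_iff]
    have h : y * (y⁻¹ * x * y) = x * y := by group
    rwa [hy] at h)
  refine ⟨a, ?_, fun s hs => h2 s fun y hy => hs ?_⟩
  · rw [h1]
    have : k ≠ 0 := by
      rintro rfl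
      rw [zero_mul] at hk
      exact Nat.card_pos.ne hk
    exact_mod_cast this
  · rw [hmem] at hy
    exact isConj_iff.mpr ⟨y⁻¹, by rw [inv_inv, hy]⟩

end Separation

/-! ### The `p`-regular part as a uniform power map. -/

section RegularExponent

/-- An exponent `e` such that `g ^ e` is the `p`-regular part of `g` for all `g`. -/
def IsRegularExponent (G : Type*) [Group G] (p e : ℕ) : Prop :=
  ∃ a m : ℕ, Nat.card G = p ^ a * m ∧ ¬ p ∣ m ∧ p ^ a ∣ e ∧ e ≡ 1 [MOD m]

lemma exists_isRegularExponent (G : Type*) [Group G] [Finite G] {p : ℕ} (hp : p.Prime) :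
    ∃ e, IsRegularExponent G p e := by
  obtain ⟨a, m, hm, h⟩ := Nat.exists_eq_pow_mul_and_not_dvd (Nat.card_pos (α := G)).ne' p
    hp.ne_one
  have hcop : (p ^ a).Coprime m := Nat.Coprime.pow_left _ ((hp.coprime_iff_not_dvd).mpr hm)
  obtain ⟨e, he0, he1⟩ := Nat.chineseRemainder hcop 0 1
  exact ⟨e, a, m, h, hm, (Nat.modEq_zero_iff_dvd).mp he0, he1⟩

variable {G : Type*} [Group G] {p e : ℕ}

lemma IsRegularExponent.pow_eq_self (he : IsRegularExponent G p e) (hp : p.Prime) {r : G}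
    (hr : ¬ p ∣ orderOf r) : r ^ e = r := by
  obtain ⟨a, m, hn, -, -, h1⟩ := he
  have hdvd : orderOf r ∣ p ^ a * m := hn ▸ orderOf_dvd_natCard r
  have hm : orderOf r ∣ m := (Nat.Coprime.pow_right a
    ((hp.coprime_iff_not_dvd).mpr hr).symm).dvd_of_dvd_mul_left hdvd
  conv_rhs => rw [← pow_one r]
  exact pow_eq_pow_iff_modEq.mpr (h1.of_dvd hm)

lemma IsRegularExponent.pow_eq_one (he : IsRegularExponent G p e) (hp : p.Prime) {u : G} {k : ℕ}
    (hu : orderOf u = p ^ k) : u ^ e = 1 := by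
  obtain ⟨a, m, hn, hm, h0, -⟩ := he
  have hdvd : orderOf u ∣ p ^ a * m := hn ▸ orderOf_dvd_natCard u
  have ha : orderOf u ∣ p ^ a := by
    rw [hu] at hdvd ⊢
    exact (Nat.Coprime.pow_left k ((hp.coprime_iff_not_dvd).mpr hm)).dvd_of_dvd_mul_right hdvd
  exact orderOf_dvd_iff_pow_eq_one.mp (ha.trans h0)

lemma IsRegularExponent.not_dvd_orderOf (he : IsRegularExponent G p e) (g : G) :
    ¬ p ∣ orderOf (g ^ e) := by
  obtain ⟨a, m, hn, hm, h0, -⟩ := he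
  refine fun h => hm (h.trans (orderOf_dvd_iff_pow_eq_one.mpr ?_))
  rw [← pow_mul, ← orderOf_dvd_iff_pow_eq_one]
  exact (orderOf_dvd_natCard g).trans (hn ▸ Nat.mul_dvd_mul_right h0 m)

lemma IsRegularExponent.isRegularPart_iff (he : IsRegularExponent G p e) (hp : p.Prime) (g r : G) :
    IsRegularPart p g r ↔ r = g ^ e := by
  constructor
  · rintro ⟨hr, hrg, u, hug, rfl, k, hk⟩
    have hc : Commute u r := by
      obtain ⟨i, hi⟩ := hrg
      obtain ⟨j, hj⟩ := hug
      simp only at hi hj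
      have h := ((Commute.refl (u * r)).zpow_right i).zpow_left j
      rwa [hi, hj] at h
    rw [hc.mul_pow, he.pow_eq_one hp hk, he.pow_eq_self hp hr, one_mul]
  · rintro rfl
    refine ⟨he.not_dvd_orderOf g, ⟨e, by simp⟩, g * (g ^ e)⁻¹, ?_, by group, ?_⟩
    · exact mul_mem (Subgroup.mem_zpowers g) (inv_mem (pow_mem (Subgroup.mem_zpowers g) e))
    · obtain ⟨a, m, hn, hm, h0, h1⟩ := he
      have : (g * (g ^ e)⁻¹) ^ p ^ a = 1 := by
        rw [(((Commute.refl g).pow_right e).inv_right).mul_pow, inv_pow, mul_inv_eq_one, ← pow_mul,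
          pow_eq_pow_iff_modEq]
        refine Nat.ModEq.of_dvd (orderOf_dvd_natCard g) ?_
        rw [hn, mul_comm, mul_comm e]
        have := (h1.symm.mul_left' (p ^ a))
        rwa [mul_one, mul_comm (p ^ a) m] at this
      obtain ⟨k, -, hk⟩ := (Nat.dvd_prime_pow hp).mp (orderOf_dvd_of_pow_eq_one this)
      exact ⟨k, hk⟩

lemma IsRegularExponent.regularPart_mk (he : IsRegularExponent G p e) (hp : p.Prime) (g : G) :
    regularPart p (ConjClasses.mk g) = (ConjClasses.mk (g ^ e)).carrier := by
  ext r
  rw [ConjClasses.mem_carrier_iff_mk_eq, ConjClasses.mk_eq_mk_iff_isConj]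
  constructor
  · rintro ⟨h, hh, hr⟩
    rw [ConjClasses.mem_carrier_iff_mk_eq, ConjClasses.mk_eq_mk_iff_isConj] at hh
    rw [he.isRegularPart_iff hp] at hr
    rw [hr]
    exact hh.pow e
  · intro h
    obtain ⟨c, hc⟩ := isConj_iff.mp h.symm
    refine ⟨c * g * c⁻¹, ?_, ?_⟩
    · rw [ConjClasses.mem_carrier_iff_mk_eq, ConjClasses.mk_eq_mk_iff_isConj]
      exact (isConj_iff.mpr ⟨c, rfl⟩ : IsConj g _).symm
    · rw [he.isRegularPart_iff hp, conj_pow, hc]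

lemma IsRegularExponent.regularPart_eq_iff (he : IsRegularExponent G p e) (hp : p.Prime) (g h : G) :
    regularPart p (ConjClasses.mk g) = regularPart p (ConjClasses.mk h) ↔
      IsConj (g ^ e) (h ^ e) := by
  rw [he.regularPart_mk hp, he.regularPart_mk hp, ← ConjClasses.mk_eq_mk_iff_isConj]
  refine ⟨fun h' => ?_, fun h' => by rw [h']⟩
  rw [← ConjClasses.mem_carrier_iff_mk_eq, ← h']
  exact ConjClasses.mem_carrier_mk

end RegularExponent

/-- For a `p`-regular element `x`, an element of `R(G) ⊗ ℤ[ξ]` whose value at `x` is an integer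
prime to `p`, and which vanishes at the `p`-regular elements not conjugate to `x`. -/
lemma exists_rbarToFun_eq_not_dvd {G : Type*} [Group G] [Finite G] {ξ : ℂ} {p : ℕ}
    (hξ : IsPrimitiveRoot ξ (Nat.card G)) (hp : p.Prime) (x : G)
    (hx : ¬ p ∣ orderOf x) :
    ∃ a : RBar G ξ, ∃ k : ℕ, ¬ p ∣ k ∧ rbarToFun hξ a (ConjClasses.mk x) = k ∧
      ∀ s : G, ¬ p ∣ orderOf s → ¬ IsConj s x → rbarToFun hξ a (ConjClasses.mk s) = 0 := by
  have : Fact p.Prime := ⟨hp⟩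
  obtain ⟨e, he⟩ := exists_isRegularExponent G hp
  let S : Sylow p (Subgroup.centralizer {x}) := default
  let P : Subgroup G := (S : Subgroup (Subgroup.centralizer {x})).map (Subgroup.subtype _)
  have hPle : P ≤ Subgroup.centralizer {x} := Subgroup.map_subtype_le _
  -- An element of `P x` is a commuting product of a `p`-element and `x`; raising to the power `e`
  -- kills the first factor and fixes `x` and all conjugates of `s`.
  have hconj (s y : G) (hs : ¬ p ∣ orderOf s) (h : y⁻¹ * s * y * x⁻¹ ∈ P) : y⁻¹ * s * y = x := by
    have hpow : (y⁻¹ * s * y * x⁻¹) ^ e = 1 := by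
      obtain ⟨z, hz, hz'⟩ := h
      obtain ⟨k, hk⟩ := (IsPGroup.iff_orderOf.mp S.isPGroup') ⟨z, hz⟩
      refine he.pow_eq_one hp (k := k) ?_
      rw [← hz', ← hk, Subgroup.orderOf_mk]
      exact Subgroup.orderOf_coe z
    have hcomm : Commute (y⁻¹ * s * y * x⁻¹) x :=
      Subgroup.mem_centralizer_singleton_iff.mp (hPle h)
    have h1 := hcomm.mul_pow e
    rw [inv_mul_cancel_right, hpow, he.pow_eq_self hp hx, one_mul] at h1
    rw [← h1]
    have h2 := conj_pow (i := e) (a := y⁻¹) (b := s)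
    rw [inv_inv, he.pow_eq_self hp hs] at h2
    exact h2.symm
  obtain ⟨a, k, hk, h1, h2⟩ := exists_rbarToFun_centralizer hξ x P hPle (by
    intro y hy
    rw [Subgroup.mem_centralizer_singleton_iff]
    have h : y * (y⁻¹ * x * y) = x * y := by group
    rwa [hconj x y hx hy] at h)
  refine ⟨a, k, ?_, h1, fun s hs hsx => h2 s fun y hy => hsx ?_⟩
  · have hcard : Nat.card P = Nat.card S :=
      Nat.card_congr (Subgroup.equivMapOfInjective _ _ (Subgroup.subtype_injective _)).symm.toEquiv
    have hidx := (S : Subgroup (Subgroup.centralizer {x})).index_mul_card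
    rw [hcard, ← hidx] at hk
    rw [Nat.eq_of_mul_eq_mul_right Nat.card_pos hk]
    exact S.not_dvd_index
  · exact isConj_iff.mpr ⟨y⁻¹, by rw [inv_inv, hconj s y hs hy]⟩

/-! ### Irreducible components through a point. -/

section Components

variable {O A ι : Type*} [CommRing O] [IsDomain O] [CommRing A] [Algebra O A] [Finite ι]

lemma exists_two_irreducibleComponents_iff (φ : ι → A →ₐ[O] O)
    (hinj : ∀ a, (∀ i, φ i a = 0) → a = 0) (hφ : Function.Injective φ) (i : ι) (Q : Ideal O)
    (x : PrimeSpectrum A) (hx : x.asIdeal = Q.comap (φ i)) :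
    (∃ Z₁ ∈ irreducibleComponents (PrimeSpectrum A), ∃ Z₂ ∈ irreducibleComponents (PrimeSpectrum A),
      Z₁ ≠ Z₂ ∧ x ∈ Z₁ ∧ x ∈ Z₂) ↔ ∃ j, j ≠ i ∧ RingHom.ker (φ j) ≤ Q.comap (φ i) := by
  have hcomp : irreducibleComponents (PrimeSpectrum A) =
      Set.range fun j => PrimeSpectrum.zeroLocus (RingHom.ker (φ j) : Set A) := by
    rw [← PrimeSpectrum.zeroLocus_minimalPrimes, minimalPrimes_eq_range_ker φ hinj,
      ← Set.range_comp]
    rfl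
  have hmem (j : ι) : x ∈ PrimeSpectrum.zeroLocus (RingHom.ker (φ j) : Set A) ↔
      RingHom.ker (φ j) ≤ Q.comap (φ i) := by
    rw [← hx]
    rfl
  rw [hcomp]
  constructor
  · rintro ⟨_, ⟨j, rfl⟩, _, ⟨k, rfl⟩, hne, hj, hk⟩
    by_cases hji : j = i
    · refine ⟨k, ?_, (hmem k).mp hk⟩
      rintro rfl
      exact hne (by rw [hji])
    · exact ⟨j, hji, (hmem j).mp hj⟩
  · rintro ⟨j, hji, hj⟩
    refine ⟨_, ⟨j, rfl⟩, _, ⟨i, rfl⟩, ?_, (hmem j).mpr hj, (hmem i).mpr fun a ha => ?_⟩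
    · intro h
      have hi : (⟨RingHom.ker (φ i), RingHom.ker_isPrime _⟩ : PrimeSpectrum A) ∈
          PrimeSpectrum.zeroLocus (RingHom.ker (φ i) : Set A) := le_refl (RingHom.ker (φ i))
      rw [← show PrimeSpectrum.zeroLocus (RingHom.ker (φ j) : Set A) =
        PrimeSpectrum.zeroLocus (RingHom.ker (φ i) : Set A) from h] at hi
      exact hji (hφ ((ker_le_ker_iff _ _).mp hi))
    · rw [Ideal.mem_comap, RingHom.mem_ker.mp ha]
      exact zero_mem _

end Components

/-! ### Independence of characters and finiteness properties of the rings. -/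

section Characters

variable {G : Type*} [Group G] [Finite G] {ξ : ℂ}

lemma linearIndependent_irrChars (G : Type*) [Group G] [Finite G] :
    LinearIndependent ℂ fun χ : irrChars G => (χ : ConjClasses G → ℂ) := by
  classical
  have : Fintype G := Fintype.ofFinite G
  have hcard : (Nat.card G : ℂ) ≠ 0 := by exact_mod_cast Nat.card_pos.ne'
  have : Invertible (Nat.card G : ℂ) := invertibleOfNonzero hcard
  let B : LinearMap.BilinForm ℂ (ConjClasses G → ℂ) := LinearMap.mk₂ ℂ
    (fun f h => (Nat.card G : ℂ)⁻¹ * ∑ g : G, f (ConjClasses.mk g) * h (ConjClasses.mk g⁻¹))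
    (fun f f' h => by simp [add_mul, Finset.sum_add_distrib, mul_add])
    (fun z f h => by
      simp only [Pi.smul_apply, smul_eq_mul, mul_assoc, ← Finset.mul_sum]
      ring)
    (fun f h h' => by simp [Finset.sum_add_distrib, mul_add])
    (fun z f h => by
      simp only [Pi.smul_apply, smul_eq_mul, mul_left_comm _ z, ← Finset.mul_sum])
  refine LinearMap.BilinForm.linearIndependent_of_iIsOrtho (B := B) ?_ ?_
  · rintro ⟨_, V, _, _, _, ρ, hρ, rfl⟩ ⟨_, W, _, _, _, σ, hσ, rfl⟩ hne
    refine (Representation.char_orthonormal ρ σ).trans (if_neg ?_)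
    rintro ⟨f⟩
    refine hne (Subtype.ext ?_)
    funext c
    induction c using Quotient.inductionOn with
    | h g => exact (congrFun (Representation.char_iso f) g).symm
  · rintro ⟨_, V, _, _, _, ρ, hρ, rfl⟩
    have : B (classChar ρ) (classChar ρ) = 1 :=
      (Representation.char_orthonormal ρ ρ).trans (if_pos ⟨Representation.Equiv.refl ρ⟩)
    change B (classChar ρ) (classChar ρ) ≠ 0
    rw [this]
    exact one_ne_zero

/-- The irreducible characters span `R(G) ⊗ ℤ[ξ]` over `ℤ[ξ]`, and their images are independent over
`ℂ`, hence over `ℤ[ξ]`. -/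
lemma rbarToFun_injective (hξ : IsPrimitiveRoot ξ (Nat.card G)) :
    Function.Injective (rbarToFun hξ) := by
  let R (χ : irrChars G) : repRing G := ⟨χ, AddSubgroup.subset_closure χ.2⟩
  let Φ : (irrChars G →₀ ZXi ξ) →+ RBar G ξ := Finsupp.liftAddHom fun χ =>
    (TensorProduct.mk ℤ (repRing G) (ZXi ξ) (R χ)).toAddMonoidHom
  have hΦ (χ : irrChars G) (z : ZXi ξ) : Φ (Finsupp.single χ z) = R χ ⊗ₜ z := by
    rw [Finsupp.liftAddHom_apply_single]
    rfl
  have hsurj (a : RBar G ξ) : a ∈ Φ.range := by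
    induction a using TensorProduct.induction_on with
    | zero => exact zero_mem _
    | add x y hx hy => exact add_mem hx hy
    | tmul χ z =>
      obtain ⟨χ, hχ⟩ := χ
      change χ ∈ AddSubgroup.closure (irrChars G) at hχ
      induction hχ using AddSubgroup.closure_induction with
      | zero =>
        rw [show (⟨0, zero_mem _⟩ : repRing G) = 0 from rfl, TensorProduct.zero_tmul]
        exact zero_mem _
      | add x y hx hy h1 h2 =>
        rw [show (⟨x + y, add_mem hx hy⟩ : repRing G) = ⟨x, hx⟩ + ⟨y, hy⟩ from rfl,
          TensorProduct.add_tmul]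
        exact add_mem h1 h2
      | neg x hx h =>
        rw [show (⟨-x, neg_mem hx⟩ : repRing G) = -⟨x, hx⟩ from rfl, TensorProduct.neg_tmul]
        exact neg_mem h
      | mem x hx => exact ⟨Finsupp.single ⟨x, hx⟩ z, hΦ _ _⟩
  have hli : LinearIndependent (ZXi ξ) fun χ : irrChars G => (χ : ConjClasses G → ℂ) := by
    refine (linearIndependent_irrChars G).restrict_scalars fun a b h => ?_
    ext
    simpa [Subalgebra.smul_def] using h
  have hval (l : irrChars G →₀ ZXi ξ) (c : ConjClasses G) :
      (rbarToFun hξ (Φ l) c : ℂ) =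
        Finsupp.linearCombination (ZXi ξ) (fun χ : irrChars G => (χ : ConjClasses G → ℂ)) l c := by
    induction l using Finsupp.induction_linear with
    | zero => simp
    | add l l' h h' => simp only [map_add, Pi.add_apply, AddMemClass.coe_add, h, h']
    | single χ z =>
      rw [hΦ, Finsupp.linearCombination_single]
      exact mul_comm _ _
  rw [injective_iff_map_eq_zero]
  intro a ha
  obtain ⟨l, rfl⟩ := hsurj a
  have hl : l = 0 := by
    refine (linearIndependent_iff.mp hli) l ?_
    funext c
    rw [← hval, ha]
    rfl
  rw [hl, map_zero]

/-- An embedding of the cyclotomic field into `ℂ` identifies its ring of integers with `ℤ[ξ]`. -/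
lemma isDedekindDomain_ZXi {n : ℕ} (hn : n ≠ 0) (hξ : IsPrimitiveRoot ξ n) :
    IsDedekindDomain (ZXi ξ) := by
  have : NeZero n := ⟨hn⟩
  let K := CyclotomicField n ℚ
  have hcyc : IsCyclotomicExtension {n} ℚ K := CyclotomicField.isCyclotomicExtension n ℚ
  let f₀ : K →ₐ[ℚ] ℂ := IsAlgClosed.lift
  let f : K →ₐ[ℤ] ℂ := (f₀ : K →+* ℂ).toIntAlgHom
  have hf : Function.Injective f := (f₀ : K →+* ℂ).injective
  obtain ⟨ζ, hζ, hζξ⟩ : ∃ ζ : K, IsPrimitiveRoot ζ n ∧ f ζ = ξ := by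
    have h := (IsCyclotomicExtension.zeta_spec n ℚ K).map_of_injective hf
    obtain ⟨i, -, hi⟩ := h.eq_pow_of_pow_eq_one hξ.pow_eq_one
    rw [← map_pow] at hi
    exact ⟨_, IsPrimitiveRoot.of_map_of_injective (f := f) (by rwa [hi]) hf, hi⟩
  let e := hζ.adjoinEquivRingOfIntegers
  have hmap : (Algebra.adjoin ℤ {ζ}).map f = ZXi ξ := by
    rw [AlgHom.map_adjoin_singleton, hζξ]
  let e' : Algebra.adjoin ℤ {ζ} ≃ₐ[ℤ] ZXi ξ :=
    (Subalgebra.equivMapOfInjective _ f hf).trans (Subalgebra.equivOfEq _ _ hmap)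
  let E : NumberField.RingOfIntegers K ≃+* ZXi ξ := (e.symm.trans e').toRingEquiv
  have h1 : IsNoetherianRing (ZXi ξ) := isNoetherianRing_of_ringEquiv _ E
  have h2 : Ring.DimensionLEOne (ZXi ξ) := Ring.DimensionLEOne.of_ringEquiv E.symm
  have h3 : IsIntegrallyClosed (ZXi ξ) := IsIntegrallyClosed.of_equiv E
  exact {}

lemma isNoetherianRing_RBar (hξ : IsPrimitiveRoot ξ (Nat.card G)) :
    IsNoetherianRing (RBar G ξ) := by
  have hint : IsIntegral ℤ ξ := hξ.isIntegral Nat.card_pos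
  have hfin : Module.Finite ℤ (ZXi ξ) := Module.Finite.iff_fg.mpr hint.fg_adjoin_singleton
  have : Module.Finite ℤ (RBar G ξ) :=
    Module.Finite.of_injective (rbarToFun hξ).toIntAlgHom.toLinearMap (rbarToFun_injective hξ)
  exact IsNoetherianRing.of_finite ℤ _

/-- If `e ≡ 1` modulo the prime-to-`p` part of `n`, every `n`-th root of unity `μ` satisfies
`μ ≡ μ ^ e` modulo each prime ideal of residue characteristic `p`. -/
lemma sub_pow_mem_of_modEq_one {n p a m e : ℕ} (hn : n = p ^ a * m) (h1 : e ≡ 1 [MOD m])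
    (hp : p.Prime) {O : Type*} [CommRing O] (Q : Ideal O) [Q.IsPrime] [CharP (O ⧸ Q) p] (μ : O)
    (hμ : μ ^ n = 1) : μ - μ ^ e ∈ Q := by
  have : Fact p.Prime := ⟨hp⟩
  rw [← Ideal.Quotient.eq_zero_iff_mem]
  -- In characteristic `p` the Frobenius power turns the difference into `μ ^ (p ^ a) - μ ^ (e * p ^
  -- a)`, and these exponents agree modulo `n`.
  refine eq_zero_of_pow_eq_zero (n := p ^ a) ?_
  rw [map_sub, sub_pow_char_pow, ← map_pow, ← map_pow, ← map_sub, ← pow_mul, sub_eq_zero.mpr,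
    map_zero]
  have hmod : p ^ a ≡ e * p ^ a [MOD n] := by
    have := h1.symm.mul_left' (p ^ a)
    rwa [mul_one, ← hn, mul_comm _ e] at this
  exact pow_eq_pow_of_modEq hmod hμ

end Characters

/-! ### Which classes are congruent modulo a prime. -/

section Congruence

variable {G : Type*} [Group G] [Finite G] {ξ : ℂ}

/-- `ℤ[ξ]` is integral over `ℤ`, so a nonzero prime contains a nonzero integer. -/
lemma prime_of_charP_quotient (hξ : IsPrimitiveRoot ξ (Nat.card G)) (Q : Ideal (ZXi ξ))
    [Q.IsPrime] (hQ : Q ≠ ⊥) (p : ℕ) [CharP (ZXi ξ ⧸ Q) p] : p.Prime := by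
  refine (CharP.char_is_prime_or_zero (ZXi ξ ⧸ Q) p).resolve_right ?_
  rintro rfl
  have hint : Algebra.IsIntegral ℤ (ZXi ξ) := by
    have : Module.Finite ℤ (ZXi ξ) :=
      Module.Finite.iff_fg.mpr (hξ.isIntegral Nat.card_pos).fg_adjoin_singleton
    infer_instance
  obtain ⟨x, hx, hx0⟩ := Submodule.exists_mem_ne_zero_of_ne_bot hQ
  refine Ideal.comap_ne_bot_of_integral_mem hx0 hx (hint.isIntegral x) (eq_bot_iff.mpr ?_)
  intro z hz
  rw [Ideal.mem_comap, ← Ideal.Quotient.eq_zero_iff_mem, algebraMap_int_eq, eq_intCast,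
    map_intCast, CharP.intCast_eq_zero_iff (ZXi ξ ⧸ Q) 0] at hz
  simpa using hz

/-- Two classes are not separated by `R(G) ⊗ ℤ[ξ]` modulo a prime `Q` exactly if they are equal or
`Q` is nonzero and their regular parts with respect to the residue characteristic agree. -/
lemma forall_rbarToFun_sub_mem_iff (hξ : IsPrimitiveRoot ξ (Nat.card G)) (Q : Ideal (ZXi ξ))
    [Q.IsPrime] (p : ℕ) [CharP (ZXi ξ ⧸ Q) p] {c d : ConjClasses G} (hdc : d ≠ c) :
    (∀ a, rbarToFun hξ a d - rbarToFun hξ a c ∈ Q) ↔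
      Q ≠ ⊥ ∧ regularPart p c = regularPart p d := by
  obtain ⟨g, rfl⟩ := ConjClasses.exists_rep c
  obtain ⟨h, rfl⟩ := ConjClasses.exists_rep d
  by_cases hQ : Q = ⊥
  · refine iff_of_false (fun hall => ?_) fun h' => h'.1 hQ
    obtain ⟨a, ha, ha'⟩ := exists_rbarToFun_ne_zero hξ g
    have := hall a
    rw [ha' h fun hc => hdc (ConjClasses.mk_eq_mk_iff_isConj.mpr hc), hQ, zero_sub,
      Ideal.mem_bot, neg_eq_zero] at this
    exact ha this
  have hp := prime_of_charP_quotient hξ Q hQ p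
  obtain ⟨e, he⟩ := exists_isRegularExponent G hp
  have hroot (μ : ZXi ξ) (hμ : μ ^ Nat.card G = 1) : μ - μ ^ e ∈ Q := by
    obtain ⟨b, m, hn, -, -, h1⟩ := he
    exact sub_pow_mem_of_modEq_one hn h1 hp Q μ hμ
  have hpow := rbarToFun_sub_pow_mem hξ Q e hroot
  rw [he.regularPart_eq_iff hp, and_iff_right hQ]
  constructor
  · intro hall
    by_contra hnc
    -- Modulo `Q` the values of `a` at `g ^ e`, `g`, `h`, `h ^ e` all agree; the first is `k` and
    -- the last is `0`, forcing `p ∣ k`.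
    obtain ⟨a, k, hk, h1, h2⟩ := exists_rbarToFun_eq_not_dvd hξ hp (g ^ e) (he.not_dvd_orderOf g)
    have h3 := h2 (h ^ e) (he.not_dvd_orderOf h) fun hc => hnc hc.symm
    have hg := hpow a g
    have hh := hpow a h
    rw [h1] at hg
    rw [h3, sub_zero] at hh
    have hkQ : (k : ZXi ξ) ∈ Q := by
      have := Q.sub_mem hh (Q.add_mem (hall a) hg)
      convert this using 1
      ring
    rw [← Ideal.Quotient.eq_zero_iff_mem, map_natCast,
      CharP.cast_eq_zero_iff (ZXi ξ ⧸ Q) p] at hkQ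
    exact hk hkQ
  · intro hc a
    have := Q.sub_mem (hpow a h) (hpow a g)
    rwa [ConjClasses.mk_eq_mk_iff_isConj.mpr hc, sub_sub_sub_cancel_right] at this

lemma regularPart_injective_of_not_dvd {G : Type*} [Group G] {p : ℕ} (hp : p.Prime) (hpG : ¬ p ∣ Nat.card G) :
    Function.Injective (regularPart p : ConjClasses G → Set G) := by
  intro c d h
  obtain ⟨g, rfl⟩ := ConjClasses.exists_rep c
  obtain ⟨k, rfl⟩ := ConjClasses.exists_rep d
  -- For `p` prime to the group order every element is its own `p`-regular part, so the exponent `1`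
  -- works.
  have he : IsRegularExponent G p 1 := ⟨0, Nat.card G, by simp, hpG, by simp, rfl⟩
  rw [he.regularPart_eq_iff hp, pow_one, pow_one] at h
  exact ConjClasses.mk_eq_mk_iff_isConj.mpr h

lemma isSingularPoint_spec_iff {R : Type*} [CommRing R]
    (x : PrimeSpectrum R) :
    IsSingularPoint (AlgebraicGeometry.Spec (CommRingCat.of R)) x ↔
      ¬ IsRegularLocalRing (Localization.AtPrime x.asIdeal) := by
  let e : (AlgebraicGeometry.Spec (CommRingCat.of R)).presheaf.stalk x ≃+*
      Localization.AtPrime x.asIdeal :=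
    (AlgebraicGeometry.Spec.stalkIso (CommRingCat.of R) x).commRingCatIsoToRingEquiv
  exact not_congr ⟨fun _ => IsRegularLocalRing.of_ringEquiv e,
    fun _ => IsRegularLocalRing.of_ringEquiv e.symm⟩

end Congruence

theorem mainTheorem4 {G : Type*} [Group G] [Finite G] {ξ : ℂ}
    (hξ : IsPrimitiveRoot ξ (Nat.card G)) (Q : PrimeSpectrum (RepSpec.ZXi ξ)) (c : ConjClasses G)
    (p : ℕ) (hp : CharP (RepSpec.ZXi ξ ⧸ Q.asIdeal) p) :
    List.TFAE
      [RepSpec.IsSingularPoint (RepSpec.specRBar G ξ) (RepSpec.point hξ Q c),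
        ∃ Z₁ ∈ irreducibleComponents (RepSpec.specRBar G ξ),
          ∃ Z₂ ∈ irreducibleComponents (RepSpec.specRBar G ξ),
            Z₁ ≠ Z₂ ∧ RepSpec.point hξ Q c ∈ Z₁ ∧ RepSpec.point hξ Q c ∈ Z₂,
        Q.asIdeal ≠ ⊥ ∧ ∃ d : ConjClasses G, d ≠ c ∧
          RepSpec.regularPart p c = RepSpec.regularPart p d] ∧
    (¬ p ∣ Nat.card G →
      ¬ RepSpec.IsSingularPoint (RepSpec.specRBar G ξ) (RepSpec.point hξ Q c)) := by
  -- Scalars act through the right tensor factor, which makes each evaluation a retraction of the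
  -- structure map.
  let : Algebra (ZXi ξ) (RBar G ξ) := Algebra.TensorProduct.rightAlgebra
  let φ (d : ConjClasses G) : RBar G ξ →ₐ[ZXi ξ] ZXi ξ :=
    { (Pi.evalRingHom (fun _ => ZXi ξ) d).comp (rbarToFun hξ) with
      commutes' := fun z => one_mul z }
  have hinj (a : RBar G ξ) (ha : ∀ d, φ d a = 0) : a = 0 :=
    rbarToFun_injective hξ (by rw [map_zero]; exact funext ha)
  have hφ : Function.Injective φ := by
    intro d₁ d₂ h
    obtain ⟨g, rfl⟩ := ConjClasses.exists_rep d₁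
    obtain ⟨k, rfl⟩ := ConjClasses.exists_rep d₂
    obtain ⟨a, ha, ha'⟩ := exists_rbarToFun_ne_zero hξ g
    by_contra hne
    refine ha ((DFunLike.congr_fun h a).trans (ha' k fun hc => hne ?_))
    exact (ConjClasses.mk_eq_mk_iff_isConj.mpr hc).symm
  have := isDedekindDomain_ZXi Nat.card_pos.ne' hξ
  have := isNoetherianRing_RBar hξ
  have := Q.isPrime
  have hsep (d : ConjClasses G) (hd : d ≠ c) :
      RingHom.ker (φ d) ≤ Q.asIdeal.comap (φ c) ↔
        Q.asIdeal ≠ ⊥ ∧ regularPart p c = regularPart p d :=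
    (ker_le_comap_iff _ _ _).trans (forall_rbarToFun_sub_mem_iff hξ Q.asIdeal p hd)
  have hiii : (∃ d, d ≠ c ∧ RingHom.ker (φ d) ≤ Q.asIdeal.comap (φ c)) ↔
      Q.asIdeal ≠ ⊥ ∧ ∃ d : ConjClasses G, d ≠ c ∧ regularPart p c = regularPart p d := by
    constructor
    · rintro ⟨d, hd, h⟩
      exact ⟨((hsep d hd).mp h).1, d, hd, ((hsep d hd).mp h).2⟩
    · rintro ⟨hQ, d, hd, h⟩
      exact ⟨d, hd, (hsep d hd).mpr ⟨hQ, h⟩⟩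
  have hi : IsSingularPoint (specRBar G ξ) (point hξ Q c) ↔
      ∃ d, d ≠ c ∧ RingHom.ker (φ d) ≤ Q.asIdeal.comap (φ c) := by
    refine (isSingularPoint_spec_iff (R := RBar G ξ) (point hξ Q c)).trans ?_
    refine (not_congr (isRegularLocalRing_localization_comap_iff φ hinj hφ c Q.asIdeal)).trans ?_
    push Not
    exact exists_congr fun d => and_comm
  have hii := exists_two_irreducibleComponents_iff φ hinj hφ c Q.asIdeal (point hξ Q c) rfl
  refine ⟨?_, fun hpG hs => ?_⟩
  · tfae_have 1 ↔ 3 := hi.trans hiii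
    tfae_have 2 ↔ 3 := hii.trans hiii
    tfae_finish
  · obtain ⟨hQ, d, hd, h⟩ := hiii.mp (hi.mp hs)
    exact hd (regularPart_injective_of_not_dvd (prime_of_charP_quotient hξ Q.asIdeal hQ p) hpG
      h.symm)
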